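/- Let $\mathbb P$ be a nonempty countable set of propositional variables, and let formulas be given by $\varphi ::= p \mid \neg\varphi \mid \varphi\wedge\varphi \mid L_r\varphi \mid \bigcirc\varphi$ with $p\in\mathbb P$ and $r\in\mathbb Q\cap[0,1]$. The connectives $\bot,\to,\leftrightarrow$ are the usual abbreviations (with $\bot = p_0\wedge\neg p_0$ for a fixed $p_0 \in \mathbb P$); $\bigcirc^n$ is the $n$-fold iterate of $\bigcirc$ (with $\bigcirc^0\varphi=\varphi$), and $L_{r_1\dots r_k}\varphi$ stands for $L_{r_1}L_{r_2}\cdots L_{r_k}\varphi$. The proof system $\mathcal H^-_{\mathsf{DPL}}$ has as axioms all propositional tautologies (in the full language, with variables and formulas $L_r\varphi$, $\bigcirc\varphi$ as atoms) and all instances of $L_0\bot$; $L_r\neg\varphi\to\neg L_s\varphi$ if $r+s>1$; $L_r(\varphi\wedge\psi)\wedge L_s(\varphi\wedge\neg\psi)\to L_{r+s}\varphi$ if $r+s\le 1$; $\neg L_r(\varphi\wedge\psi)\wedge \neg L_s(\varphi\wedge\neg\psi)\to \neg L_{r+s}\varphi$ if $r+s\le 1$; $L_1(\varphi\to\psi)\to(L_r\varphi\to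 L_r\psi)$; $\bigcirc\neg\varphi\leftrightarrow\neg\bigcirc\varphi$; $\bigcirc(\varphi\wedge\psi)\leftrightarrow(\bigcirc\varphi\wedge\bigcirc\psi)$. Its rules are modus ponens, necessitation (from $\varphi$ infer $L_1\varphi$; from $\varphi$ infer $\bigcirc\varphi$), and the Archimedean rule: from $\{\psi\to\bigcirc^nL_s\varphi \mid s\in\mathbb Q\cap[0,1],\ s<r\}$ infer $\psi\to\bigcirc^nL_r\varphi$ ($n\ge0$, $r\in\mathbb Q\cap[0,1]$). The system $\mathcal H_{\mathsf{DPL}}$ is obtained by replacing the Archimedean rule by the generalized Archimedean rule: from $\{\psi\to\bigcirc^nL_{r_1\dots r_ks}\varphi \mid s\in\mathbb Q\cap[0,1],\ s<r\}$ infer $\psi\to\bigcirc^nL_{r_1\dots r_kr}\varphi$ ($n,k\ge0$, $r_1,\dots,r_k,r\in\mathbb Q\cap[0,1]$). A formula $\varphi$ is derivable in a system (is a theorem of it) if there are a countable ordinal $\alpha$ and a sequence of formulas $(\varphi_\beta)_{\beta\le\alpha+1}$ with $\varphi_{\alpha+1}=\varphi$, each entry of which is an axiom or follows by a rule from (possibly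 infinitely many) preceding entries. It is derivable from a set $\Gamma$ if there is such a sequence each entry of which is a member of $\Gamma$, a theorem of the system, or follows from preceding entries by a rule other than the two necessitation rules. A set $\Gamma$ is consistent in a system if $\bot$ is not derivable from $\Gamma$ in it. Then: 1. a formula is derivable in $\mathcal H^-_{\mathsf{DPL}}$ if and only if it is derivable in $\mathcal H_{\mathsf{DPL}}$; 2. for every finite set $\Gamma$ of formulas and every formula $\varphi$, $\varphi$ is derivable from $\Gamma$ in $\mathcal H^-_{\mathsf{DPL}}$ if and only if it is derivable from $\Gamma$ in $\mathcal H_{\mathsf{DPL}}$; 3. consequently, a finite set $\Gamma$ of formulas is consistent in $\mathcal H^-_{\mathsf{DPL}}$ if and only if it is consistent in $\mathcal H_{\mathsf{DPL}}$. -/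

import Mathlib

namespace DPL

/-- The rational numbers in the unit interval, used as indices of the probability modalities. -/
abbrev Idx : Type := Set.Icc (0 : ℚ) 1

/-- Formulas of dynamic probability logic over the set `P` of propositional variables:
`φ ::= p | ¬φ | φ ∧ φ | L_r φ | ○φ`. -/
inductive Formula (P : Type*) : Type _
  | var : P → Formula P
  | neg : Formula P → Formula P
  | and : Formula P → Formula P → Formula P
  | L : Idx → Formula P → Formula P
  | next : Formula P → Formula P

namespace Formula

variable {P : Type*}

/-- `φ → ψ`, that is `¬(φ ∧ ¬ψ)`. -/
def imp (φ ψ : Formula P) : Formula P := neg (and φ (neg ψ))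

/-- `φ ↔ ψ`, that is `(φ → ψ) ∧ (ψ → φ)`. -/
def iff (φ ψ : Formula P) : Formula P := and (imp φ ψ) (imp ψ φ)

/-- `⊥`, that is `p₀ ∧ ¬p₀` for a fixed propositional variable `p₀`. -/
noncomputable def bot [Nonempty P] : Formula P :=
  and (var (Classical.arbitrary P)) (neg (var (Classical.arbitrary P)))

/-- `○ⁿ φ`, with `○⁰ φ = φ`. -/
def nexts : ℕ → Formula P → Formula P
  | 0, φ => φ
  | n + 1, φ => next (nexts n φ)

/-- `L_{r₁ … r_k} φ`, that is `L_{r₁} (L_{r₂} (… (L_{r_k} φ)))`; it is `φ` for the empty list. -/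
def Ls : List Idx → Formula P → Formula P
  | [], φ => φ
  | r :: l, φ => L r (Ls l φ)

/-- The truth value of a formula under a propositional valuation `v` that treats the
propositional variables and all formulas of the form `L_r φ` and `○φ` as atoms. -/
def PropTrue (v : Formula P → Prop) : Formula P → Prop
  | var p => v (var p)
  | neg φ => ¬ PropTrue v φ
  | and φ ψ => PropTrue v φ ∧ PropTrue v ψ
  | L r φ => v (L r φ)
  | next φ => v (next φ)

/-- Propositional tautologies (in the full language). -/
def IsTautology (φ : Formula P) : Prop := ∀ v : Formula P → Prop, PropTrue v φ

end Formula

open Formula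

/-- The instances of the axiom schemes, which are common to both proof systems. -/
inductive IsAxiomInstance {P : Type*} [Nonempty P] : Formula P → Prop
  | taut (φ : Formula P) : IsTautology φ → IsAxiomInstance φ
  | fa1 : IsAxiomInstance (L 0 bot)
  | fa2 (r s : Idx) (φ : Formula P) : (r : ℚ) + s > 1 →
      IsAxiomInstance (imp (L r (neg φ)) (neg (L s φ)))
  | fa3 (r s t : Idx) (φ ψ : Formula P) : (t : ℚ) = r + s →
      IsAxiomInstance (imp (and (L r (and φ ψ)) (L s (and φ (neg ψ)))) (L t φ))
  | fa4 (r s t : Idx) (φ ψ : Formula P) : (t : ℚ) = r + s →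
      IsAxiomInstance
        (imp (and (neg (L r (and φ ψ))) (neg (L s (and φ (neg ψ))))) (neg (L t φ)))
  | mono (r : Idx) (φ ψ : Formula P) :
      IsAxiomInstance (imp (L 1 (imp φ ψ)) (imp (L r φ) (L r ψ)))
  | func (φ : Formula P) : IsAxiomInstance (iff (next (neg φ)) (neg (next φ)))
  | conj (φ ψ : Formula P) :
      IsAxiomInstance (iff (next (and φ ψ)) (and (next φ) (next ψ)))

/-- An inference rule, as a relation between the set of premises and the conclusion. -/
abbrev InferenceRule (P : Type*) := Set (Formula P) → Formula P → Prop

/-- Modus ponens. -/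
inductive MP {P : Type*} : InferenceRule P
  | intro (φ ψ : Formula P) : MP {imp φ ψ, φ} ψ

/-- The necessitation rules for `L₁` and for `○`. -/
inductive Nec {P : Type*} : InferenceRule P
  | probability (φ : Formula P) : Nec {φ} (L 1 φ)
  | dynamic (φ : Formula P) : Nec {φ} (next φ)

/-- The Archimedean rule: from `ψ → ○ⁿ L_s φ` for all `s < r`, infer `ψ → ○ⁿ L_r φ`. -/
inductive Arch {P : Type*} : InferenceRule P
  | intro (n : ℕ) (r : Idx) (φ ψ : Formula P) :
      Arch {χ | ∃ s : Idx, s < r ∧ χ = imp ψ (nexts n (L s φ))}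
        (imp ψ (nexts n (L r φ)))

/-- The generalized Archimedean rule: from `ψ → ○ⁿ L_{r₁ … r_k s} φ` for all `s < r`,
infer `ψ → ○ⁿ L_{r₁ … r_k r} φ`. -/
inductive GArch {P : Type*} : InferenceRule P
  | intro (n : ℕ) (l : List Idx) (r : Idx) (φ ψ : Formula P) :
      GArch {χ | ∃ s : Idx, s < r ∧ χ = imp ψ (nexts n (Ls l (L s φ)))}
        (imp ψ (nexts n (Ls l (L r φ))))

section Derivations

variable {P : Type*} [Nonempty P]

/-- The entry of the sequence `σ` at position `β` is the conclusion of an instance of the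
rule `R` all of whose premises occur at earlier positions. -/
def FollowsBy (R : InferenceRule P) (σ : Ordinal.{0} → Formula P) (β : Ordinal.{0}) : Prop :=
  ∃ H : Set (Formula P), R H (σ β) ∧ ∀ χ ∈ H, ∃ γ < β, σ γ = χ

/-- `φ` is a theorem of the proof system whose rules are modus ponens, the necessitation rules
and `A`: it is the last entry of a sequence `φ_0, …, φ_{α+1}`, with `α` a countable ordinal, each
entry of which is an instance of an axiom scheme or follows by a rule from earlier entries.
Only the values of `σ` at the positions `β ≤ α + 1` matter. -/
def Derivable (A : InferenceRule P) (φ : Formula P) : Prop :=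
  ∃ (α : Ordinal.{0}) (σ : Ordinal.{0} → Formula P),
    α.card ≤ Cardinal.aleph0 ∧ σ (α + 1) = φ ∧
      ∀ β ≤ α + 1,
        IsAxiomInstance (σ β) ∨ FollowsBy MP σ β ∨ FollowsBy A σ β ∨ FollowsBy Nec σ β

/-- `φ` is derivable from the set `Γ` of assumptions, in the proof system whose rules are
modus ponens, the necessitation rules and `A`: as above, but each entry is a member of `Γ`,
a theorem of the system, or follows from earlier entries by a rule other than necessitation. -/
def DerivableFrom (A : InferenceRule P) (Γ : Set (Formula P)) (φ : Formula P) : Prop :=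
  ∃ (α : Ordinal.{0}) (σ : Ordinal.{0} → Formula P),
    α.card ≤ Cardinal.aleph0 ∧ σ (α + 1) = φ ∧
      ∀ β ≤ α + 1,
        σ β ∈ Γ ∨ Derivable A (σ β) ∨ FollowsBy MP σ β ∨ FollowsBy A σ β

/-- A set of formulas is consistent if `⊥` is not derivable from it. -/
def Consistent (A : InferenceRule P) (Γ : Set (Formula P)) : Prop :=
  ¬ DerivableFrom A Γ bot

end Derivations

end DPL

/-! The Archimedean rule is the case `l = []` of the generalized one, so only one direction needs
work. It goes through finite models: `GArch` is sound for them, and `Arch` is already weakly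
complete for them.

Soundness (`FiniteModel.sat_of_GArch`): over finitely many points `φ` has only finitely many masses,
so for `r > 0` one `s < r` makes `L s φ` imply `L r φ` at every point (`exists_lt_sat_L`). An
implication valid at every point survives any prefix of `L`'s and `○`'s, since these are monotone.

Completeness (`derivable_of_forall_sat`): a consistent formula lies in a maximal consistent set
closed under `Arch`, by a Rasiowa–Sikorski argument (`exists_satSet`). Each such set induces a
finitely additive probability on formulas (`prob_add`) with `L r φ` a member iff `r ≤ prob φ`
(`mem_L_iff`). Filtration through the subformulas of `φ` gives a finite model satisfying the truth
lemma `sat_filtration_iff`.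

A finite `Γ` is absorbed into the single formula `γ₁ → … → γₖ → φ`. -/

namespace DPL

open Formula

/-! ### Countability of the language -/

section CountableFormulas

/-- A Gödel numbering of formulas, relative to numberings of the variables and the indices. -/
def Formula.code {P : Type*} (e : P → ℕ) (d : Idx → ℕ) : Formula P → ℕ
  | var p => Nat.pair 0 (e p)
  | neg φ => Nat.pair 1 (code e d φ)
  | and φ ψ => Nat.pair 2 (Nat.pair (code e d φ) (code e d ψ))
  | L r φ => Nat.pair 3 (Nat.pair (d r) (code e d φ))
  | next φ => Nat.pair 4 (code e d φ)

theorem Formula.code_injective {P : Type*} {e : P → ℕ} {d : Idx → ℕ}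
    (he : Function.Injective e) (hd : Function.Injective d) :
    Function.Injective (code e d) := by
  intro φ
  induction φ with
  | var p => intro ψ h; cases ψ <;> simp [code, Nat.pair_eq_pair] at h ⊢; exact he h
  | neg φ ih => intro ψ h; cases ψ <;> simp [code, Nat.pair_eq_pair] at h ⊢; exact ih h
  | and φ₁ φ₂ ih₁ ih₂ =>
    intro ψ h
    cases ψ <;> simp [code, Nat.pair_eq_pair] at h ⊢
    exact ⟨ih₁ h.1, ih₂ h.2⟩
  | L r φ ih =>
    intro ψ h
    cases ψ <;> simp [code, Nat.pair_eq_pair] at h ⊢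
    exact ⟨hd h.1, ih h.2⟩
  | next φ ih => intro ψ h; cases ψ <;> simp [code, Nat.pair_eq_pair] at h ⊢; exact ih h

/-- Countability is used twice: a rule has only countably many premises, so derivations of them
concatenate to countable length; and the Rasiowa–Sikorski argument meets only countably many
requirements. -/
instance Formula.instCountable {P : Type*} [Countable P] : Countable (Formula P) := by
  obtain ⟨e, he⟩ := exists_injective_nat P
  obtain ⟨d, hd⟩ := exists_injective_nat Idx
  exact (code_injective he hd).countable

end CountableFormulas

/-! ### Concatenation of transfinite derivations -/

section Sequences

variable {P : Type*}

/-- `φ` is the last entry of a sequence of countable length, each entry of which satisfies `B` or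
follows from earlier entries by the rule `R`. -/
def SeqDerivable (B : Formula P → Prop) (R : InferenceRule P) (φ : Formula P) : Prop :=
  ∃ (α : Ordinal.{0}) (σ : Ordinal.{0} → Formula P),
    α.card ≤ Cardinal.aleph0 ∧ σ (α + 1) = φ ∧ ∀ β ≤ α + 1, B (σ β) ∨ FollowsBy R σ β

variable {B : Formula P → Prop} {R : InferenceRule P}

theorem FollowsBy.congr {σ τ : Ordinal.{0} → Formula P} {β β' : Ordinal.{0}}
    (h : FollowsBy R σ β) (hβ : τ β' = σ β) (H : ∀ γ < β, ∃ γ' < β', τ γ' = σ γ) :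
    FollowsBy R τ β' := by
  obtain ⟨S, hS, hp⟩ := h
  refine ⟨S, hβ ▸ hS, fun χ hχ => ?_⟩
  obtain ⟨γ, hγ, rfl⟩ := hp χ hχ
  exact H γ hγ

theorem FollowsBy.mono {R' : InferenceRule P} (hR : ∀ H φ, R H φ → R' H φ)
    {σ : Ordinal.{0} → Formula P} {β : Ordinal.{0}} (h : FollowsBy R σ β) :
    FollowsBy R' σ β := by
  obtain ⟨S, hS, hp⟩ := h
  exact ⟨S, hR _ _ hS, hp⟩

theorem SeqDerivable.base {φ : Formula P} (h : B φ) : SeqDerivable B R φ :=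
  ⟨0, fun _ => φ, by simp, rfl, fun _ _ => Or.inl h⟩

/-- Padding with `b` after the last entry makes every position correct, so derivations of different
lengths can be cut into blocks of one common length. -/
theorem SeqDerivable.exists_total {b φ : Formula P} (hb : B b) (h : SeqDerivable B R φ) :
    ∃ (α : Ordinal.{0}) (σ : Ordinal.{0} → Formula P),
      α.card ≤ Cardinal.aleph0 ∧ σ (α + 1) = φ ∧ ∀ β, B (σ β) ∨ FollowsBy R σ β := by
  obtain ⟨α, σ, hα, hφ, hσ⟩ := h
  refine ⟨α, fun β => if β ≤ α + 1 then σ β else b, hα, by simp [hφ], fun β => ?_⟩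
  by_cases hβ : β ≤ α + 1
  · simp only [hβ, if_true]
    refine (hσ β hβ).imp id fun h => h.congr (by simp [hβ]) fun γ hγ => ⟨γ, hγ, ?_⟩
    simp [hγ.le.trans hβ]
  · simp [hβ, hb]

/-- The sequences of derivations with premises in `H` can be concatenated. -/
theorem SeqDerivable.rule [Countable P] {b : Formula P} (hb : B b) {H : Set (Formula P)}
    {φ : Formula P} (hR : R H φ) (h : ∀ χ ∈ H, SeqDerivable B R χ) : SeqDerivable B R φ := by
  -- Adding `b` permits an enumeration by `ℕ` even when `H` is empty, as for the Archimedean rule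
  -- with `r = 0`.
  obtain ⟨f, hf⟩ := (Set.to_countable (insert b H)).exists_eq_range ⟨b, Set.mem_insert b H⟩
  have hd : ∀ n, SeqDerivable B R (f n) := fun n => by
    have hn : f n ∈ insert b H := hf ▸ Set.mem_range_self n
    rcases hn with hn | hn
    · exact hn ▸ .base hb
    · exact h _ hn
  choose α τ hα hτ hgood using fun n => (hd n).exists_total hb
  set κ : Ordinal.{0} := (⨆ n, α n) + 2 with hκ
  have hακ : ∀ n, α n + 1 < κ := fun n => by
    have h1 : α n ≤ ⨆ n, α n := Ordinal.le_iSup α n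
    calc α n + 1 ≤ (⨆ n, α n) + 1 := by gcongr
      _ < κ := by rw [hκ, ← one_add_one_eq_two, ← add_assoc]; exact lt_add_one _
  have hκ0 : κ ≠ 0 := fun h0 => by simpa [h0] using hακ 0
  have hκc : κ.card ≤ Cardinal.aleph0 := by
    rw [hκ, Ordinal.card_add]
    refine Cardinal.add_le_aleph0.2 ⟨Ordinal.card_iSup_le (by simp) hα, ?_⟩
    simp
  let N : Ordinal.{0} → ℕ := fun o => Cardinal.toNat o.card
  have hN : ∀ n : ℕ, N n = n := fun n => by simp [N]
  let ω := Ordinal.omega0.{0}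
  -- Position `κ * n + β` carries entry `β` of the `n`-th derivation. The conclusion has to sit at a
  -- position `α + 1`, here with `α = κ * ω`; position `κ * ω` itself is filled with `b`.
  let σ : Ordinal.{0} → Formula P := fun x =>
    if x < κ * ω then τ (N (x / κ)) (x % κ) else if x = κ * ω then b else φ
  have hlt : ∀ (n : ℕ) β, β < κ → κ * n + β < κ * ω := fun n β hβ => by
    rw [Ordinal.lt_mul_iff_div_lt hκ0, Ordinal.mul_add_div _ hκ0, Ordinal.div_eq_zero_of_lt hβ, add_zero]
    exact Ordinal.natCast_lt_omega0 n
  have hσ : ∀ (n : ℕ) β, β < κ → σ (κ * n + β) = τ n β := fun n β hβ => by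
    simp only [σ, hlt n β hβ, if_true, Ordinal.mul_add_div _ hκ0, Ordinal.div_eq_zero_of_lt hβ,
      add_zero, hN, Ordinal.mul_add_mod_self, Ordinal.mod_eq_of_lt hβ]
  have hlast : σ (κ * ω + 1) = φ := by simp [σ]
  refine ⟨κ * ω, σ, ?_, hlast, fun x hx => ?_⟩
  · rw [Ordinal.card_mul]
    exact (mul_le_mul' hκc Ordinal.card_omega0.le).trans Cardinal.aleph0_mul_aleph0.le
  rcases lt_or_ge x (κ * ω) with hx' | hx'
  · obtain ⟨n, hn⟩ := Ordinal.lt_omega0.1 ((Ordinal.lt_mul_iff_div_lt hκ0).1 hx')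
    have hmod := Ordinal.mod_lt x hκ0
    have hxe : κ * n + x % κ = x := by rw [← hn, Ordinal.div_add_mod]
    generalize x % κ = β at hmod hxe
    subst hxe
    rw [hσ n β hmod]
    refine (hgood n β).imp id fun h => h.congr (hσ n β hmod) fun γ hγ => ?_
    exact ⟨κ * n + γ, by simpa using hγ, hσ n γ (hγ.trans hmod)⟩
  · rcases hx'.eq_or_lt with rfl | hx'
    · left; simpa [σ] using hb
    · obtain rfl : x = κ * ω + 1 := le_antisymm hx (Order.add_one_le_of_lt hx')
      right
      refine ⟨H, hlast ▸ hR, fun χ hχ => ?_⟩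
      obtain ⟨n, rfl⟩ : χ ∈ Set.range f := hf ▸ Set.mem_insert_of_mem b hχ
      exact ⟨κ * n + (α n + 1), (hlt n _ (hακ n)).trans (lt_add_one _), by
        rw [hσ n _ (hακ n), hτ]⟩

end Sequences

/-! ### Closure of derivability under the rules -/

section Closure

variable {P : Type*} [Nonempty P] {A : InferenceRule P}

theorem derivable_iff_seqDerivable {φ : Formula P} :
    Derivable A φ ↔
      SeqDerivable IsAxiomInstance (fun H φ => MP H φ ∨ A H φ ∨ Nec H φ) φ := by
  simp only [Derivable, SeqDerivable, FollowsBy, or_and_right, exists_or]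

theorem derivableFrom_iff_seqDerivable {Γ : Set (Formula P)} {φ : Formula P} :
    DerivableFrom A Γ φ ↔
      SeqDerivable (fun χ => χ ∈ Γ ∨ Derivable A χ) (fun H φ => MP H φ ∨ A H φ) φ := by
  simp only [DerivableFrom, SeqDerivable, FollowsBy, or_and_right, exists_or, or_assoc]

theorem Derivable.ax {φ : Formula P} (h : IsAxiomInstance φ) : Derivable A φ :=
  derivable_iff_seqDerivable.2 (.base h)

theorem DerivableFrom.mem {Γ : Set (Formula P)} {φ : Formula P} (h : φ ∈ Γ) :
    DerivableFrom A Γ φ :=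
  derivableFrom_iff_seqDerivable.2 (.base (.inl h))

theorem Derivable.derivableFrom {Γ : Set (Formula P)} {φ : Formula P} (h : Derivable A φ) :
    DerivableFrom A Γ φ :=
  derivableFrom_iff_seqDerivable.2 (.base (.inr h))

theorem Derivable.mono {A' : InferenceRule P} (hA : ∀ H φ, A H φ → A' H φ) {φ : Formula P}
    (h : Derivable A φ) : Derivable A' φ := by
  obtain ⟨α, σ, hα, hφ, hσ⟩ := h
  exact ⟨α, σ, hα, hφ, fun β hβ =>
    (hσ β hβ).imp id <| Or.imp id <| Or.imp (FollowsBy.mono hA) id⟩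

theorem DerivableFrom.mono {A' : InferenceRule P} (hA : ∀ H φ, A H φ → A' H φ)
    {Γ : Set (Formula P)} {φ : Formula P} (h : DerivableFrom A Γ φ) : DerivableFrom A' Γ φ := by
  obtain ⟨α, σ, hα, hφ, hσ⟩ := h
  exact ⟨α, σ, hα, hφ, fun β hβ =>
    (hσ β hβ).imp id <| Or.imp (Derivable.mono hA) <| Or.imp id (FollowsBy.mono hA)⟩

theorem Derivable.taut {a : Formula P} (h : ∀ v, PropTrue v a) : Derivable A a :=
  .ax (.taut a h)

variable [Countable P]

theorem Derivable.rule {H : Set (Formula P)} {φ : Formula P} (hR : MP H φ ∨ A H φ ∨ Nec H φ)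
    (h : ∀ χ ∈ H, Derivable A χ) : Derivable A φ :=
  derivable_iff_seqDerivable.2 <| SeqDerivable.rule .fa1 hR fun χ hχ =>
    derivable_iff_seqDerivable.1 (h χ hχ)

theorem Derivable.mp {φ ψ : Formula P} (h : Derivable A (imp φ ψ)) (h' : Derivable A φ) :
    Derivable A ψ :=
  Derivable.rule (.inl (.intro φ ψ)) (by simp [h, h'])

theorem Derivable.necL {φ : Formula P} (h : Derivable A φ) : Derivable A (L 1 φ) :=
  Derivable.rule (.inr (.inr (.probability φ))) (by simp [h])

theorem Derivable.necNext {φ : Formula P} (h : Derivable A φ) : Derivable A (next φ) :=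
  Derivable.rule (.inr (.inr (.dynamic φ))) (by simp [h])

theorem DerivableFrom.mp {Γ : Set (Formula P)} {φ ψ : Formula P}
    (h : DerivableFrom A Γ (imp φ ψ)) (h' : DerivableFrom A Γ φ) : DerivableFrom A Γ ψ :=
  derivableFrom_iff_seqDerivable.2 <|
    SeqDerivable.rule (b := L 0 bot) (.inr (.ax .fa1)) (.inl (.intro φ ψ)) <| by
      simpa [derivableFrom_iff_seqDerivable] using And.intro h h'

theorem Derivable.arch {n : ℕ} {r : Idx} {φ ψ : Formula P}
    (h : ∀ s < r, Derivable Arch (imp ψ (nexts n (L s φ)))) :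
    Derivable Arch (imp ψ (nexts n (L r φ))) :=
  Derivable.rule (.inr (.inl (.intro n r φ ψ))) (by rintro _ ⟨s, hs, rfl⟩; exact h s hs)

/-- Tautological consequences of a theorem are theorems. -/
theorem Derivable.taut₁ {a b : Formula P} (ha : Derivable A a)
    (h : ∀ v, PropTrue v a → PropTrue v b) : Derivable A b :=
  Derivable.mp (.ax (.taut (imp a b) fun v => by simpa [PropTrue, imp] using h v)) ha

theorem Derivable.taut₂ {a b c : Formula P} (ha : Derivable A a) (hb : Derivable A b)
    (h : ∀ v, PropTrue v a → PropTrue v b → PropTrue v c) : Derivable A c :=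
  Derivable.mp (ha.taut₁ (b := imp b c) fun v => by simpa [PropTrue, imp] using h v) hb

end Closure

@[simp] theorem propTrue_imp {P : Type*} (v : Formula P → Prop) (φ ψ : Formula P) :
    PropTrue v (imp φ ψ) ↔ (PropTrue v φ → PropTrue v ψ) := by
  simp [imp, PropTrue]

@[simp] theorem propTrue_neg {P : Type*} (v : Formula P → Prop) (φ : Formula P) :
    PropTrue v (neg φ) ↔ ¬ PropTrue v φ := Iff.rfl

@[simp] theorem propTrue_and {P : Type*} (v : Formula P → Prop) (φ ψ : Formula P) :
    PropTrue v (and φ ψ) ↔ PropTrue v φ ∧ PropTrue v ψ := Iff.rfl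

/-! ### Saturated sets and their probabilities -/

section SaturatedSets

variable {P : Type*} [Nonempty P]

/-- A maximal consistent set of formulas that is closed under the Archimedean rule. -/
structure SatSet (P : Type*) [Nonempty P] where
  carrier : Set (Formula P)
  thm_mem {φ : Formula P} : Derivable Arch φ → φ ∈ carrier
  mp_mem {φ ψ : Formula P} : imp φ ψ ∈ carrier → φ ∈ carrier → ψ ∈ carrier
  neg_mem_iff {φ : Formula P} : neg φ ∈ carrier ↔ φ ∉ carrier
  arch_mem {n : ℕ} {r : Idx} {φ : Formula P} :
    (∀ s < r, nexts n (L s φ) ∈ carrier) → nexts n (L r φ) ∈ carrier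

instance : Membership (Formula P) (SatSet P) := ⟨fun Γ φ => φ ∈ Γ.carrier⟩

/-- The formulas that are consistent with the theorems of the system with the Archimedean rule. -/
def ConsistentFormula (P : Type*) [Nonempty P] : Type _ :=
  {θ : Formula P // ¬ Derivable Arch (neg θ)}

namespace SatSet

variable (Γ : SatSet P) {φ ψ : Formula P}

theorem ax {φ : Formula P} (h : IsAxiomInstance φ) : φ ∈ Γ := Γ.thm_mem (.ax h)

theorem mp {Γ : SatSet P} {φ ψ : Formula P} (h : imp φ ψ ∈ Γ) (h' : φ ∈ Γ) : ψ ∈ Γ :=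
  Γ.mp_mem h h'

@[simp] theorem mem_neg : neg φ ∈ Γ ↔ φ ∉ Γ := Γ.neg_mem_iff

@[simp] theorem mem_and : and φ ψ ∈ Γ ↔ φ ∈ Γ ∧ ψ ∈ Γ := by
  refine ⟨fun h => ⟨?_, ?_⟩, fun h => ?_⟩
  · exact mp (Γ.thm_mem (.taut fun v => by simp; tauto)) h
  · exact mp (Γ.thm_mem (.taut fun v => by simp)) h
  · exact mp (mp (φ := φ) (Γ.thm_mem (.taut fun v => by simp; tauto)) h.1) h.2

@[simp] theorem mem_imp : imp φ ψ ∈ Γ ↔ (φ ∈ Γ → ψ ∈ Γ) := by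
  simp [imp]

@[simp] theorem mem_iff : iff φ ψ ∈ Γ ↔ (φ ∈ Γ ↔ ψ ∈ Γ) := by
  simp [iff, iff_def]

@[simp] theorem not_mem_bot : bot ∉ Γ := by
  simp [bot]

theorem mem_next_neg : next (neg φ) ∈ Γ ↔ next φ ∉ Γ := by
  simpa using Γ.ax (.func φ)

theorem mem_next_and : next (and φ ψ) ∈ Γ ↔ next φ ∈ Γ ∧ next ψ ∈ Γ := by
  simpa using Γ.ax (.conj φ ψ)

/-- The probability that a saturated set assigns to a formula. -/
noncomputable def prob (φ : Formula P) : ℝ := sSup {x | ∃ r : Idx, L r φ ∈ Γ ∧ x = ((r : ℚ) : ℝ)}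

theorem bddAbove_prob : BddAbove {x | ∃ r : Idx, L r φ ∈ Γ ∧ x = ((r : ℚ) : ℝ)} :=
  ⟨1, by rintro _ ⟨r, -, rfl⟩; exact_mod_cast r.2.2⟩

end SatSet

variable [Countable P]

/-- Stronger formulas are larger, as forcing conditions: a saturated set is read off from an ideal
that meets countably many cofinal sets. -/
instance : Preorder (ConsistentFormula P) where
  le θ θ' := Derivable Arch (imp θ'.1 θ.1)
  le_refl θ := .taut fun v => by simp
  le_trans θ₁ θ₂ θ₃ h h' := h.taut₂ h' fun v => by simp; tauto

theorem isCofinal_decides (φ : Formula P) :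
    IsCofinal {θ : ConsistentFormula P |
      Derivable Arch (imp θ.1 φ) ∨ Derivable Arch (imp θ.1 (neg φ))} := by
  intro θ
  by_cases h : Derivable Arch (neg (and θ.1 φ))
  · exact ⟨θ, .inr (h.taut₁ fun v => by simp), le_rfl⟩
  · exact ⟨⟨and θ.1 φ, h⟩, .inl (.taut fun v => by simp), Derivable.taut fun v => by simp; tauto⟩

/-- The Archimedean rule with context `ψ = θ` is used here: if `θ` does not imply the conclusion, it
fails to imply some premise, whose negation can be added consistently. -/
theorem isCofinal_witness (n : ℕ) (r : Idx) (φ : Formula P) :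
    IsCofinal {θ : ConsistentFormula P | Derivable Arch (imp θ.1 (nexts n (L r φ))) ∨
      ∃ s < r, Derivable Arch (imp θ.1 (neg (nexts n (L s φ))))} := by
  intro θ
  by_cases h : ∀ s < r, Derivable Arch (imp θ.1 (nexts n (L s φ)))
  · exact ⟨θ, .inl (.arch h), le_rfl⟩
  · push Not at h
    obtain ⟨s, hs, h⟩ := h
    refine ⟨⟨and θ.1 (neg (nexts n (L s φ))), fun h' => h (h'.taut₁ fun v => by simp)⟩,
      .inr ⟨s, hs, .taut fun v => by simp⟩, Derivable.taut fun v => by simp; tauto⟩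

/-- Every consistent formula belongs to a saturated set. -/
theorem exists_satSet {θ : Formula P} (hθ : ¬ Derivable Arch (neg θ)) :
    ∃ Γ : SatSet P, θ ∈ Γ := by
  let _ : Encodable (Formula P ⊕ (ℕ × Idx × Formula P)) := Encodable.ofCountable _
  let D : Formula P ⊕ (ℕ × Idx × Formula P) → Order.Cofinal (ConsistentFormula P)
    | .inl φ => ⟨_, isCofinal_decides φ⟩
    | .inr (n, r, φ) => ⟨_, isCofinal_witness n r φ⟩
  let p : ConsistentFormula P := ⟨θ, hθ⟩
  let I := Order.idealOfCofinals p D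
  have key : ∀ {φ ψ χ : Formula P}, (∃ η ∈ I, Derivable Arch (imp η.1 φ)) →
      (∃ η ∈ I, Derivable Arch (imp η.1 ψ)) →
      (∀ v, PropTrue v φ → PropTrue v ψ → PropTrue v χ) →
      ∃ η ∈ I, Derivable Arch (imp η.1 χ) := by
    rintro φ ψ χ ⟨η₁, h₁, d₁⟩ ⟨η₂, h₂, d₂⟩ h
    obtain ⟨η, hη, l₁, l₂⟩ := I.directed _ h₁ _ h₂
    have e₁ : Derivable Arch (imp η.1 φ) := Derivable.taut₂ l₁ d₁ fun v => by simp; tauto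
    have e₂ : Derivable Arch (imp η.1 ψ) := Derivable.taut₂ l₂ d₂ fun v => by simp; tauto
    refine ⟨η, hη, e₁.taut₂ e₂ fun v => ?_⟩
    have := h v
    simp; tauto
  have key' : ∀ {φ : Formula P}, (∃ η ∈ I, Derivable Arch (imp η.1 φ)) →
      ¬ ∃ η ∈ I, Derivable Arch (imp η.1 (neg φ)) := by
    intro φ h h'
    obtain ⟨η, -, h⟩ := key (χ := and φ (neg φ)) h h' fun v => by simp
    exact η.2 (h.taut₁ fun v => by simp)
  refine ⟨⟨{φ | ∃ η ∈ I, Derivable Arch (imp η.1 φ)}, fun {φ} h => ?_, fun {φ ψ} h h' => ?_,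
    fun {φ} => ⟨fun h h' => key' h' h, fun h => ?_⟩, fun {n r φ} h => ?_⟩, ?_⟩
  · exact ⟨p, Order.mem_idealOfCofinals p D, h.taut₁ fun v => by simp; tauto⟩
  · exact key h h' fun v => by simp
  · obtain ⟨η, hη, hI⟩ := Order.cofinal_meets_idealOfCofinals p D (.inl φ)
    exact ⟨η, hI, Or.resolve_left hη fun h' => h ⟨η, hI, h'⟩⟩
  -- The ideal contains either a condition implying the conclusion or one refuting a premise; the
  -- latter contradicts `h`.
  · obtain ⟨η, hη, hI⟩ := Order.cofinal_meets_idealOfCofinals p D (.inr (n, r, φ))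
    rcases hη with hη | ⟨s, hs, hη⟩
    · exact ⟨η, hI, hη⟩
    · exact (key' (h s hs) ⟨η, hI, hη⟩).elim
  · exact ⟨p, Order.mem_idealOfCofinals p D, .taut fun v => by simp [p]⟩

/-- A formula that belongs to all saturated sets is a theorem. -/
theorem derivable_of_forall_mem {φ : Formula P} (h : ∀ Γ : SatSet P, φ ∈ Γ) :
    Derivable Arch φ := by
  by_contra hφ
  obtain ⟨Γ, hΓ⟩ := exists_satSet (θ := neg φ) fun h' => hφ (h'.taut₁ fun v => by simp)
  exact Γ.neg_mem_iff.1 hΓ (h Γ)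

namespace SatSet

variable (Γ : SatSet P) {φ ψ : Formula P}

/-- The formulas that hold at the next moment. -/
def shift : SatSet P where
  carrier := {φ | next φ ∈ Γ}
  thm_mem h := Γ.thm_mem h.necNext
  mp_mem h h' := by
    simp only [imp, Set.mem_ofPred_eq, mem_next_neg, mem_next_and] at h h'
    tauto
  neg_mem_iff := Γ.mem_next_neg
  -- The prefix `○ⁿ` in the Archimedean rule is what makes saturation survive the shift.
  arch_mem {n _ _} h := Γ.arch_mem (n := n + 1) h

@[simp] theorem mem_shift : φ ∈ Γ.shift ↔ next φ ∈ Γ := Iff.rfl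

/-- Membership in all saturated sets gives derivability, hence necessitation applies. From here on,
syntactic derivations are replaced by checks of membership. -/
theorem mem_L_one (h : ∀ Δ : SatSet P, φ ∈ Δ) : L 1 φ ∈ Γ :=
  Γ.thm_mem (derivable_of_forall_mem h).necL

theorem mem_L_mono (h : ∀ Δ : SatSet P, φ ∈ Δ → ψ ∈ Δ) {r : Idx} (hr : L r φ ∈ Γ) :
    L r ψ ∈ Γ :=
  mp (mp (Γ.ax (.mono r φ ψ)) (Γ.mem_L_one fun Δ => Δ.mem_imp.2 (h Δ))) hr

theorem mem_L_zero : L 0 φ ∈ Γ :=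
  Γ.mem_L_mono (fun Δ h => (Δ.not_mem_bot h).elim) (Γ.ax .fa1)

theorem not_mem_L_of_forall_not_mem (h : ∀ Δ : SatSet P, φ ∉ Δ) {r : Idx} (hr : 0 < r) :
    L r φ ∉ Γ := fun hL => by
  have h1 := Γ.ax (.fa2 r 1 (neg φ) (by
    have : (0 : ℚ) < r := hr
    simpa using this))
  simp only [mem_imp, mem_neg] at h1
  exact h1 (Γ.mem_L_mono (fun Δ => by simp) hL) (Γ.mem_L_one fun Δ => by simpa using h Δ)

/-- Write `t = s + (t - s)` and apply `fa4` with `ψ = φ`: the contradiction `φ ∧ ¬φ` has no positive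
lower bound `t - s`. -/
theorem mem_L_anti {s t : Idx} (hst : s ≤ t) (ht : L t φ ∈ Γ) : L s φ ∈ Γ := by
  rcases hst.eq_or_lt with rfl | hlt
  · exact ht
  by_contra hs
  have hlt' : (s : ℚ) < t := hlt
  have h0 := s.2.1
  have h1 := t.2.2
  let u : Idx := ⟨t - s, by linarith, by linarith⟩
  have h := Γ.ax (.fa4 s u t φ φ (by simp [u]))
  simp only [mem_imp, mem_and, mem_neg] at h
  refine h ⟨fun h' => hs (Γ.mem_L_mono (fun Δ => by simp) h'), ?_⟩ ht
  exact Γ.not_mem_L_of_forall_not_mem (fun Δ => by simp) (show (0 : ℚ) < t - s by linarith)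

theorem exists_lt_of_lt_prob {x : ℝ} (h : x < Γ.prob φ) :
    ∃ r : Idx, L r φ ∈ Γ ∧ x < ((r : ℚ) : ℝ) := by
  obtain ⟨_, ⟨r, hr, rfl⟩, hx⟩ := exists_lt_of_lt_csSup (by
    exact ⟨_, 0, Γ.mem_L_zero, rfl⟩) h
  exact ⟨r, hr, hx⟩

/-- Closure under the Archimedean rule says that the supremum defining `prob` is attained whenever
it is rational. -/
theorem mem_L_iff {r : Idx} : L r φ ∈ Γ ↔ ((r : ℚ) : ℝ) ≤ Γ.prob φ := by
  refine ⟨fun h => le_csSup Γ.bddAbove_prob ⟨r, h, rfl⟩, fun h => ?_⟩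
  refine Γ.arch_mem (n := 0) fun s hs => ?_
  have hs' : ((s : ℚ) : ℝ) < (r : ℚ) := by exact_mod_cast hs
  obtain ⟨t, ht, hst⟩ := Γ.exists_lt_of_lt_prob (hs'.trans_le h)
  have hst' : (s : ℚ) < t := by exact_mod_cast hst
  exact Γ.mem_L_anti hst'.le ht

theorem prob_nonneg : 0 ≤ Γ.prob φ := by
  simpa using Γ.mem_L_iff.1 (Γ.mem_L_zero (φ := φ))

theorem prob_mono (h : ∀ Δ : SatSet P, φ ∈ Δ → ψ ∈ Δ) : Γ.prob φ ≤ Γ.prob ψ := by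
  refine csSup_le ⟨_, 0, Γ.mem_L_zero, rfl⟩ ?_
  rintro _ ⟨r, hr, rfl⟩
  exact Γ.mem_L_iff.1 (Γ.mem_L_mono h hr)

theorem prob_congr (h : ∀ Δ : SatSet P, φ ∈ Δ ↔ ψ ∈ Δ) : Γ.prob φ = Γ.prob ψ :=
  (Γ.prob_mono fun Δ => (h Δ).1).antisymm (Γ.prob_mono fun Δ => (h Δ).2)

theorem prob_eq_zero (h : ∀ Δ : SatSet P, φ ∉ Δ) : Γ.prob φ = 0 := by
  refine le_antisymm (csSup_le ⟨_, 0, Γ.mem_L_zero, rfl⟩ ?_) Γ.prob_nonneg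
  rintro _ ⟨r, hr, rfl⟩
  by_contra hr0
  have : (0 : ℚ) < r := by exact_mod_cast not_le.1 hr0
  exact Γ.not_mem_L_of_forall_not_mem h this hr

theorem prob_eq_one (h : ∀ Δ : SatSet P, φ ∈ Δ) : Γ.prob φ = 1 := by
  refine le_antisymm (csSup_le ⟨_, 0, Γ.mem_L_zero, rfl⟩ ?_) ?_
  · rintro _ ⟨r, -, rfl⟩
    exact_mod_cast r.2.2
  · simpa using Γ.mem_L_iff.1 (Γ.mem_L_one h)

theorem prob_add : Γ.prob (and φ ψ) + Γ.prob (and φ (neg ψ)) = Γ.prob φ := by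
  apply le_antisymm
  · by_contra! hlt
    set m₁ := Γ.prob (and φ ψ)
    set m₂ := Γ.prob (and φ (neg ψ))
    set ε := (m₁ + m₂ - Γ.prob φ) / 2 with hε
    obtain ⟨r, hr, hr'⟩ := Γ.exists_lt_of_lt_prob (φ := and φ ψ) (x := m₁ - ε)
      (show m₁ - ε < m₁ by linarith)
    obtain ⟨s, hs, hs'⟩ := Γ.exists_lt_of_lt_prob (φ := and φ (neg ψ)) (x := m₂ - ε)
      (show m₂ - ε < m₂ by linarith)
    -- By the choice of `ε`, `r + s` exceeds `prob φ`. If `r + s ≤ 1`, this contradicts `fa3`;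
    -- otherwise `fa2` applies, as `φ ∧ ψ` and `φ ∧ ¬ψ` exclude each other.
    by_cases h1 : (r : ℚ) + s ≤ 1
    · have h := Γ.ax (.fa3 r s ⟨r + s, add_nonneg r.2.1 s.2.1, h1⟩ φ ψ rfl)
      simp only [mem_imp, mem_and] at h
      have := Γ.mem_L_iff.1 (h ⟨hr, hs⟩)
      push_cast at this
      linarith
    · have h := Γ.ax (.fa2 s r (and φ ψ) (by linarith))
      simp only [mem_imp, mem_neg] at h
      exact h (Γ.mem_L_mono (fun Δ => by simp; tauto) hs) hr
  · by_contra! hlt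
    obtain ⟨t, ht, ht'⟩ := Γ.exists_lt_of_lt_prob hlt
    -- Split `t` as `r + (t - r)` with each summand above the corresponding probability; `fa4` then
    -- refutes `L t φ`.
    obtain ⟨r, hr, hr'⟩ := exists_rat_btwn (lt_sub_iff_add_lt.2 ht')
    have h₁ := Γ.prob_nonneg (φ := and φ ψ)
    have h₂ := Γ.prob_nonneg (φ := and φ (neg ψ))
    have hr0 : (0 : ℚ) < r := by exact_mod_cast h₁.trans_lt hr
    have hrt : r < t := by
      have : (r : ℝ) < (t : ℚ) := by linarith
      exact_mod_cast this
    have ht1 := t.2.2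
    let a : Idx := ⟨r, by linarith, by linarith⟩
    let b : Idx := ⟨t - r, by linarith, by linarith⟩
    have h := Γ.ax (.fa4 a b t φ ψ (by simp [a, b]))
    simp only [mem_imp, mem_and, mem_neg, mem_L_iff, a, b] at h
    push_cast at h
    exact h ⟨by linarith, by linarith⟩ (Γ.mem_L_iff.1 ht)

end SatSet

end SaturatedSets

/-! ### Finite models and soundness of the generalized Archimedean rule -/

section FiniteModels

open scoped Classical in
/-- The mass of the set of points satisfying `S` for the weights `w`. -/
noncomputable def mass {X : Type*} [Fintype X] (w : X → ℝ) (S : X → Prop) : ℝ :=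
  ∑ y, if S y then w y else 0

/-- A finite dynamic Markov model. -/
structure FiniteModel (P X : Type*) [Fintype X] where
  weight : X → X → ℝ
  weight_nonneg : ∀ x y, 0 ≤ weight x y
  sum_weight : ∀ x, ∑ y, weight x y = 1
  map : X → X
  val : P → X → Prop

namespace FiniteModel

variable {P X : Type*} [Fintype X]

/-- Truth of a formula at a point of a finite model. -/
def Sat (M : FiniteModel P X) : Formula P → X → Prop
  | .var p, x => M.val p x
  | .neg φ, x => ¬ M.Sat φ x
  | .and φ ψ, x => M.Sat φ x ∧ M.Sat ψ x
  | .L r φ, x => ((r : ℚ) : ℝ) ≤ mass (M.weight x) (M.Sat φ)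
  | .next φ, x => M.Sat φ (M.map x)

variable {M : FiniteModel P X}

@[simp] theorem sat_neg {φ : Formula P} {x : X} : M.Sat (neg φ) x ↔ ¬ M.Sat φ x := Iff.rfl

@[simp] theorem sat_and {φ ψ : Formula P} {x : X} :
    M.Sat (and φ ψ) x ↔ M.Sat φ x ∧ M.Sat ψ x := Iff.rfl

@[simp] theorem sat_imp {φ ψ : Formula P} {x : X} :
    M.Sat (imp φ ψ) x ↔ (M.Sat φ x → M.Sat ψ x) := by
  simp [imp]

@[simp] theorem sat_iff {φ ψ : Formula P} {x : X} :
    M.Sat (iff φ ψ) x ↔ (M.Sat φ x ↔ M.Sat ψ x) := by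
  simp [iff, iff_def]

@[simp] theorem sat_next {φ : Formula P} {x : X} :
    M.Sat (next φ) x ↔ M.Sat φ (M.map x) := Iff.rfl

theorem sat_L {r : Idx} {φ : Formula P} {x : X} :
    M.Sat (L r φ) x ↔ ((r : ℚ) : ℝ) ≤ mass (M.weight x) (M.Sat φ) := Iff.rfl

theorem propTrue_sat {φ : Formula P} {x : X} :
    PropTrue (fun ψ => M.Sat ψ x) φ ↔ M.Sat φ x := by
  induction φ with
  | var p => rfl
  | neg φ ih => simp [ih]
  | and φ ψ ih₁ ih₂ => simp [ih₁, ih₂]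
  | L r φ => rfl
  | next φ => rfl

variable {x : X} {S T : X → Prop}

theorem mass_mono (h : ∀ y, S y → T y) : mass (M.weight x) S ≤ mass (M.weight x) T := by
  refine Finset.sum_le_sum fun y _ => ?_
  have := M.weight_nonneg x y
  by_cases hS : S y
  · simp [hS, h y hS]
  · simp only [hS, if_false]; split_ifs <;> simp [this]

theorem mass_nonneg : 0 ≤ mass (M.weight x) S :=
  Finset.sum_nonneg fun y _ => by
    split_ifs
    · exact M.weight_nonneg x y
    · exact le_rfl

theorem mass_of_forall (h : ∀ y, S y) : mass (M.weight x) S = 1 := by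
  simp [mass, h, M.sum_weight]

theorem mass_add :
    mass (M.weight x) (fun y => S y ∧ T y) + mass (M.weight x) (fun y => S y ∧ ¬ T y) =
      mass (M.weight x) S := by
  rw [mass, mass, mass, ← Finset.sum_add_distrib]
  refine Finset.sum_congr rfl fun y _ => ?_
  by_cases S y <;> by_cases T y <;> simp [*]

theorem mass_not : mass (M.weight x) S + mass (M.weight x) (fun y => ¬ S y) = 1 := by
  have := mass_add (M := M) (x := x) (S := fun _ => True) (T := S)
  simpa [mass_of_forall (M := M) (x := x) (S := fun _ => True)] using this

theorem sat_nexts_mono {φ ψ : Formula P} (h : ∀ y, M.Sat φ y → M.Sat ψ y) (n : ℕ) :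
    ∀ y, M.Sat (nexts n φ) y → M.Sat (nexts n ψ) y := by
  induction n with
  | zero => exact h
  | succ n ih => exact fun y => ih (M.map y)

theorem sat_nexts_of_forall {φ : Formula P} (h : ∀ y, M.Sat φ y) (n : ℕ) :
    ∀ y, M.Sat (nexts n φ) y := by
  induction n with
  | zero => exact h
  | succ n ih => exact fun y => ih (M.map y)

theorem sat_Ls_mono {φ ψ : Formula P} (h : ∀ y, M.Sat φ y → M.Sat ψ y) (l : List Idx) :
    ∀ y, M.Sat (Ls l φ) y → M.Sat (Ls l ψ) y := by
  induction l with
  | nil => exact h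
  | cons r l ih => exact fun y hy => le_trans hy (mass_mono ih)

theorem sat_L_of_forall {φ : Formula P} (h : ∀ y, M.Sat φ y) (r : Idx) (x : X) :
    M.Sat (L r φ) x := by
  rw [sat_L, mass_of_forall h]
  exact_mod_cast r.2.2

theorem sat_Ls_of_forall {φ : Formula P} (h : ∀ y, M.Sat φ y) (l : List Idx) :
    ∀ y, M.Sat (Ls l φ) y := by
  induction l with
  | nil => exact h
  | cons r l ih => exact sat_L_of_forall ih r

/-- In a finite model, `L_r φ` is equivalent to `L_s φ` for some `s < r`. -/
theorem exists_lt_sat_L [Nonempty X] (M : FiniteModel P X) (φ : Formula P) {r : Idx} (hr : 0 < r) :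
    ∃ s < r, ∀ y, M.Sat (L s φ) y → M.Sat (L r φ) y := by
  have hr' : (0 : ℚ) < r := hr
  have key : ∀ y, ∃ s < r, M.Sat (L s φ) y → M.Sat (L r φ) y := fun y => by
    by_cases hy : M.Sat (L r φ) y
    · exact ⟨0, hr, fun _ => hy⟩
    · rw [sat_L, not_le] at hy
      obtain ⟨q, hq, hqr⟩ := exists_rat_btwn hy
      have hq0 : (0 : ℚ) < q := by exact_mod_cast mass_nonneg.trans_lt hq
      have hqr' : q < r := by exact_mod_cast hqr
      refine ⟨⟨q, hq0.le, hqr'.le.trans r.2.2⟩, hqr', fun h => ?_⟩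
      exact absurd hq (not_lt.2 h)
  choose s hs hsat using key
  -- Finiteness enters here: the largest of the pointwise thresholds is still below `r`, and it
  -- works at every point.
  obtain ⟨z, -, hz⟩ := Finset.exists_max_image Finset.univ s Finset.univ_nonempty
  refine ⟨s z, hs z, fun y hy => hsat y (le_trans ?_ hy)⟩
  have : (s y : ℚ) ≤ s z := hz y (Finset.mem_univ y)
  exact_mod_cast this

theorem sat_of_MP {H : Set (Formula P)} {φ : Formula P} (h : MP H φ) {x : X}
    (hH : ∀ χ ∈ H, M.Sat χ x) : M.Sat φ x := by
  obtain ⟨χ⟩ := h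
  exact sat_imp.1 (hH (imp χ φ) (by simp)) (hH χ (by simp))

theorem sat_of_Nec {H : Set (Formula P)} {φ : Formula P} (h : Nec H φ)
    (hH : ∀ χ ∈ H, ∀ x, M.Sat χ x) (x : X) : M.Sat φ x := by
  cases h with
  | probability φ => exact sat_L_of_forall (hH φ rfl) 1 x
  | dynamic φ => exact hH φ rfl (M.map x)

/-- The generalized Archimedean rule preserves truth at each point of a finite model. -/
theorem sat_of_GArch {H : Set (Formula P)} {φ : Formula P} (h : GArch H φ) {x : X}
    (hH : ∀ χ ∈ H, M.Sat χ x) : M.Sat φ x := by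
  obtain ⟨n, l, r, φ, ψ⟩ := h
  refine sat_imp.2 fun hψ => ?_
  -- For `r = 0` the rule has no premises, and its conclusion is valid because masses are
  -- nonnegative.
  rcases (show (0 : Idx) ≤ r from r.2.1).eq_or_lt with rfl | hr
  · exact sat_nexts_of_forall (sat_Ls_of_forall (fun y => by simpa [sat_L] using mass_nonneg) l) n x
  · have : Nonempty X := ⟨x⟩
    obtain ⟨s, hs, h⟩ := M.exists_lt_sat_L φ hr
    exact sat_nexts_mono (sat_Ls_mono h l) n x (sat_imp.1 (hH _ ⟨s, hs, rfl⟩) hψ)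

variable [Nonempty P]

theorem sat_of_isAxiomInstance {φ : Formula P} (h : IsAxiomInstance φ) (x : X) : M.Sat φ x := by
  cases h with
  | taut φ h => exact propTrue_sat.1 (h _)
  | fa1 => simpa [sat_L] using mass_nonneg
  | fa2 r s φ h =>
    simp only [sat_imp, sat_neg, sat_L]
    intro h₁ h₂
    have h₃ : mass (M.weight x) (M.Sat φ) + mass (M.weight x) (fun y => ¬ M.Sat φ y) = 1 :=
      mass_not
    have h₄ : (1 : ℝ) < (r : ℚ) + (s : ℚ) := by exact_mod_cast h
    have h₅ : ((r : ℚ) : ℝ) ≤ mass (M.weight x) (fun y => ¬ M.Sat φ y) := h₁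
    linarith
  | fa3 r s t φ ψ h =>
    simp only [sat_imp, sat_and, sat_L]
    rintro ⟨h₁, h₂⟩
    rw [h, ← mass_add (T := M.Sat ψ)]
    push_cast
    exact add_le_add h₁ h₂
  | fa4 r s t φ ψ h =>
    simp only [sat_imp, sat_and, sat_neg, sat_L, not_le]
    rintro ⟨h₁, h₂⟩
    rw [h, ← mass_add (T := M.Sat ψ)]
    push_cast
    exact add_lt_add h₁ h₂
  | mono r φ ψ =>
    simp only [sat_imp, sat_L]
    intro h₁ h₂
    refine h₂.trans ?_
    have e₁ := mass_add (M := M) (x := x) (S := M.Sat φ) (T := M.Sat ψ)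
    have e₂ : mass (M.weight x) (M.Sat (imp φ ψ)) +
      mass (M.weight x) (fun y => ¬ M.Sat (imp φ ψ) y) = 1 := mass_not
    have e₃ : mass (M.weight x) (fun y => M.Sat φ y ∧ M.Sat ψ y) ≤ mass (M.weight x) (M.Sat ψ) :=
      mass_mono fun y h => h.2
    have e₄ : (fun y => ¬ M.Sat (imp φ ψ) y) = fun y => M.Sat φ y ∧ ¬ M.Sat ψ y := by
      funext y; simp
    rw [e₄] at e₂
    have h₁' : (1 : ℝ) ≤ mass (M.weight x) (M.Sat (imp φ ψ)) := by simpa using h₁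
    linarith
  | func φ => simp
  | conj φ ψ => simp

theorem sat_of_derivable {φ : Formula P} (h : Derivable GArch φ) (x : X) : M.Sat φ x := by
  obtain ⟨α, σ, -, rfl, hσ⟩ := h
  -- The induction needs truth at all points, because necessitation preserves validity but not truth
  -- at one point.
  suffices ∀ β ≤ α + 1, ∀ x, M.Sat (σ β) x from this _ le_rfl x
  intro β
  induction β using WellFoundedLT.induction with
  | ind β ih =>
    intro hβ x
    have prem : ∀ {H : Set (Formula P)}, (∀ χ ∈ H, ∃ γ < β, σ γ = χ) →
        ∀ χ ∈ H, ∀ x, M.Sat χ x := fun hH χ hχ x => by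
      obtain ⟨γ, hγ, rfl⟩ := hH χ hχ
      exact ih γ hγ (hγ.le.trans hβ) x
    rcases hσ β hβ with h | ⟨H, h, hH⟩ | ⟨H, h, hH⟩ | ⟨H, h, hH⟩
    · exact sat_of_isAxiomInstance h x
    · exact sat_of_MP h fun χ hχ => prem hH χ hχ x
    · exact sat_of_GArch h fun χ hχ => prem hH χ hχ x
    · exact sat_of_Nec h (prem hH) x

/-- Without necessitation the remaining rules preserve truth at a single point, so the assumptions
need only hold at `x`. -/
theorem sat_of_derivableFrom {Γ : Set (Formula P)} {φ : Formula P} (h : DerivableFrom GArch Γ φ)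
    {x : X} (hx : ∀ γ ∈ Γ, M.Sat γ x) : M.Sat φ x := by
  obtain ⟨α, σ, -, rfl, hσ⟩ := h
  suffices ∀ β ≤ α + 1, M.Sat (σ β) x from this _ le_rfl
  intro β
  induction β using WellFoundedLT.induction with
  | ind β ih =>
    intro hβ
    have prem : ∀ {H : Set (Formula P)}, (∀ χ ∈ H, ∃ γ < β, σ γ = χ) →
        ∀ χ ∈ H, M.Sat χ x := fun hH χ hχ => by
      obtain ⟨γ, hγ, rfl⟩ := hH χ hχ
      exact ih γ hγ (hγ.le.trans hβ)
    rcases hσ β hβ with h | h | ⟨H, h, hH⟩ | ⟨H, h, hH⟩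
    · exact hx _ h
    · exact sat_of_derivable h x
    · exact sat_of_MP h (prem hH)
    · exact sat_of_GArch h (prem hH)

end FiniteModel

end FiniteModels

/-! ### Filtration and weak completeness -/

section Filtration

variable {P : Type*} [Nonempty P]

open scoped Classical in
/-- The set of subformulas. -/
noncomputable def Formula.subformulas {P : Type*} : Formula P → Finset (Formula P)
  | .var p => {var p}
  | .neg φ => insert (neg φ) φ.subformulas
  | .and φ ψ => insert (and φ ψ) (φ.subformulas ∪ ψ.subformulas)
  | .L r φ => insert (L r φ) φ.subformulas
  | .next φ => insert (next φ) φ.subformulas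

theorem Formula.mem_subformulas_self {P : Type*} (φ : Formula P) : φ ∈ φ.subformulas := by
  cases φ <;> simp [subformulas]

open scoped Classical in
/-- The conjunction of the elements of `B` and the negations of the other elements of `F`. -/
noncomputable def cell (F B : Finset (Formula P)) : Formula P :=
  (F.toList.map fun ψ => if ψ ∈ B then ψ else neg ψ).foldr Formula.and (neg bot)

theorem SatSet.mem_cell (Γ : SatSet P) {F B : Finset (Formula P)} :
    cell F B ∈ Γ ↔ ∀ ψ ∈ F, (ψ ∈ Γ ↔ ψ ∈ B) := by
  classical
  have key : ∀ l : List (Formula P),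
      (l.map fun ψ => if ψ ∈ B then ψ else neg ψ).foldr Formula.and (neg bot) ∈ Γ ↔
        ∀ ψ ∈ l, (ψ ∈ Γ ↔ ψ ∈ B) := fun l => by
    induction l with
    | nil => simp
    | cons a l ih =>
      by_cases h : a ∈ B <;> simp [ih, h]
  simpa [cell] using key F.toList

open scoped Classical in
/-- The elements of `F` that belong to `Γ`. -/
noncomputable def SatSet.trace (F : Finset (Formula P)) (Γ : SatSet P) :
    F.powerset :=
  ⟨F.filter (· ∈ Γ), by simp⟩

theorem SatSet.mem_trace {F : Finset (Formula P)} {Γ : SatSet P} {ψ : Formula P} :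
    ψ ∈ (Γ.trace F).1 ↔ ψ ∈ F ∧ ψ ∈ Γ := by
  simp [trace]

theorem SatSet.mem_iff_mem_of_trace_eq {F : Finset (Formula P)} {Γ Δ : SatSet P}
    (h : Γ.trace F = Δ.trace F) {ψ : Formula P} (hψ : ψ ∈ F) : ψ ∈ Γ ↔ ψ ∈ Δ := by
  have h₁ := mem_trace (F := F) (Γ := Γ) (ψ := ψ)
  rw [h, mem_trace] at h₁
  tauto

theorem SatSet.trace_eq_of_mem_cell {F : Finset (Formula P)} {Γ : SatSet P} {B : F.powerset}
    (h : cell F B.1 ∈ Γ) : Γ.trace F = B := by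
  have hB := Finset.mem_powerset.1 B.2
  rw [mem_cell] at h
  ext ψ
  rw [mem_trace]
  exact ⟨fun h' => (h ψ h'.1).1 h'.2, fun h' => ⟨hB h', (h ψ (hB h')).2 h'⟩⟩

theorem SatSet.mem_cell_trace {F : Finset (Formula P)} {Γ Δ : SatSet P} :
    cell F (Γ.trace F).1 ∈ Δ ↔ Δ.trace F = Γ.trace F := by
  refine ⟨trace_eq_of_mem_cell, fun h => (mem_cell _).2 fun ψ hψ => ?_⟩
  rw [← h, mem_trace]
  tauto

open scoped Classical in
/-- A saturated set with a given trace on `F`, if there is one, and `Γ₀` otherwise. -/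
noncomputable def SatSet.ofTrace (F : Finset (Formula P)) (Γ₀ : SatSet P) (B : F.powerset) :
    SatSet P :=
  if h : ∃ Γ : SatSet P, Γ.trace F = B then h.choose else Γ₀

theorem SatSet.trace_ofTrace (F : Finset (Formula P)) (Γ₀ Γ : SatSet P) :
    (ofTrace F Γ₀ (Γ.trace F)).trace F = Γ.trace F := by
  have h : ∃ Δ : SatSet P, Δ.trace F = Γ.trace F := ⟨Γ, rfl⟩
  rw [ofTrace, dif_pos h]
  exact h.choose_spec

variable [Countable P]

/-- The cells partition the saturated sets; adding a formula to `F` splits every cell in two, and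
`prob_add` accounts for the split. -/
theorem SatSet.sum_prob_cell (Γ : SatSet P) (F : Finset (Formula P)) (φ : Formula P) :
    ∑ B ∈ F.powerset, Γ.prob (and φ (cell F B)) = Γ.prob φ := by
  classical
  induction F using Finset.induction_on with
  | empty => simpa using Γ.prob_congr fun Δ => by simp [mem_cell]
  | insert a F ha ih =>
    rw [Finset.sum_powerset_insert ha, ← Finset.sum_add_distrib, ← ih]
    refine Finset.sum_congr rfl fun B hB => ?_
    have haB : a ∉ B := fun h => ha (Finset.mem_powerset.1 hB h)
    have hF : ∀ {ψ}, ψ ∈ F → ψ ≠ a := fun h h' => ha (h' ▸ h)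
    rw [← Γ.prob_add (φ := and φ (cell F B)) (ψ := a), add_comm]
    congr 1 <;> refine Γ.prob_congr fun Δ => ?_
    · simp +contextual [mem_cell, hF, and_comm]
      tauto
    · simp +contextual [mem_cell, haB, and_comm]
      tauto

/-- The filtration of the canonical model through a finite set of formulas. -/
noncomputable def filtration (F : Finset (Formula P)) (Γ₀ : SatSet P) :
    FiniteModel P F.powerset where
  -- Subsets of `F` that are no trace are points as well: they receive weight `0`, and their own
  -- transitions are those of `Γ₀`.
  weight A B := (SatSet.ofTrace F Γ₀ A).prob (cell F B.1)
  weight_nonneg A B := SatSet.prob_nonneg _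
  sum_weight A := by
    rw [Finset.sum_coe_sort F.powerset fun B => (SatSet.ofTrace F Γ₀ A).prob (cell F B)]
    rw [← (SatSet.ofTrace F Γ₀ A).prob_eq_one (φ := neg bot) (fun Δ => by simp),
      ← SatSet.sum_prob_cell _ F]
    exact Finset.sum_congr rfl fun B _ => SatSet.prob_congr _ fun Δ => by simp
  map A := (SatSet.ofTrace F Γ₀ A).shift.trace F
  val p A := var p ∈ A.1

/-- The truth lemma. Transitions at a trace come from a chosen representative, which may differ from
`Γ` but agrees with it on `F`; so both modal cases pass to the representative before anything else.
-/
theorem sat_filtration_iff (F : Finset (Formula P)) (Γ₀ : SatSet P) {φ : Formula P}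
    (hφ : φ.subformulas ⊆ F) (Γ : SatSet P) :
    (filtration F Γ₀).Sat φ (Γ.trace F) ↔ φ ∈ Γ := by
  classical
  have hF : φ ∈ F := hφ φ.mem_subformulas_self
  induction φ generalizing Γ with
  | var p =>
    change var p ∈ (Γ.trace F).1 ↔ _
    simp [SatSet.mem_trace, hF]
  | neg φ ih =>
    have h : φ.subformulas ⊆ F := (Finset.subset_insert _ _).trans hφ
    simp [ih h Γ (h φ.mem_subformulas_self)]
  | and φ ψ ih₁ ih₂ =>
    have h := (Finset.subset_insert _ _).trans hφ
    have h₁ := Finset.union_subset_left h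
    have h₂ := Finset.union_subset_right h
    simp [ih₁ h₁ Γ (h₁ φ.mem_subformulas_self), ih₂ h₂ Γ (h₂ ψ.mem_subformulas_self)]
  | next φ ih =>
    have h : φ.subformulas ⊆ F := (Finset.subset_insert _ _).trans hφ
    have e := SatSet.mem_iff_mem_of_trace_eq (SatSet.trace_ofTrace F Γ₀ Γ) hF
    rw [FiniteModel.sat_next, ← e, ← SatSet.mem_shift]
    exact ih h _ (h φ.mem_subformulas_self)
  | L r φ ih =>
    have h : φ.subformulas ⊆ F := (Finset.subset_insert _ _).trans hφ
    rw [← SatSet.mem_iff_mem_of_trace_eq (SatSet.trace_ofTrace F Γ₀ Γ) hF, FiniteModel.sat_L,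
      SatSet.mem_L_iff, ← SatSet.sum_prob_cell _ F φ, ← Finset.sum_coe_sort]
    refine iff_of_eq (congrArg _ (Finset.sum_congr rfl fun B _ => ?_))
    change (if (filtration F Γ₀).Sat φ B then
      (SatSet.ofTrace F Γ₀ (Γ.trace F)).prob (cell F B.1) else 0) = _
    -- Compare the sums cell by cell: on a realised cell `φ` is constantly in or constantly out, and
    -- an unrealised cell contributes `0` to both.
    by_cases hB : ∃ E : SatSet P, E.trace F = B
    · obtain ⟨E, rfl⟩ := hB
      have hE := ih h E (h φ.mem_subformulas_self)
      have hmem : ∀ Δ : SatSet P, cell F (E.trace F).1 ∈ Δ → (φ ∈ Δ ↔ φ ∈ E) := fun Δ hΔ =>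
        SatSet.mem_iff_mem_of_trace_eq (SatSet.mem_cell_trace.1 hΔ) (h φ.mem_subformulas_self)
      by_cases hφE : φ ∈ E
      · rw [if_pos (hE.2 hφE)]
        refine SatSet.prob_congr _ fun Δ => ?_
        have := hmem Δ
        rw [SatSet.mem_and]; tauto
      · rw [if_neg (mt hE.1 hφE)]
        refine (SatSet.prob_eq_zero _ fun Δ => ?_).symm
        have := hmem Δ
        rw [SatSet.mem_and]; tauto
    · have hc : ∀ Δ : SatSet P, cell F B.1 ∉ Δ := fun Δ hΔ =>
        hB ⟨Δ, SatSet.trace_eq_of_mem_cell hΔ⟩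
      rw [SatSet.prob_eq_zero _ hc, SatSet.prob_eq_zero _ fun Δ hΔ => hc Δ (Δ.mem_and.1 hΔ).2,
        ite_self]

/-- Weak completeness of the system with the Archimedean rule for finite models. -/
theorem derivable_of_forall_sat {φ : Formula P}
    (h : ∀ (F : Finset (Formula P)) (M : FiniteModel P F.powerset) (x : F.powerset), M.Sat φ x) :
    Derivable Arch φ :=
  derivable_of_forall_mem fun Γ => (sat_filtration_iff _ Γ subset_rfl Γ).1 (h _ _ _)

end Filtration

/-! ### Equivalence of the two systems -/

section Equivalence

variable {P : Type*}

theorem GArch.of_arch {H : Set (Formula P)} {φ : Formula P} (h : Arch H φ) : GArch H φ := by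
  obtain ⟨n, r, φ, ψ⟩ := h
  exact .intro n [] r φ ψ

variable [Nonempty P] [Countable P]

theorem derivable_arch_iff {φ : Formula P} : Derivable Arch φ ↔ Derivable GArch φ :=
  ⟨.mono fun _ _ => .of_arch, fun h => derivable_of_forall_sat fun _ _ =>
    FiniteModel.sat_of_derivable h⟩

theorem DerivableFrom.of_derivable_foldr {A : InferenceRule P} {Γ : Set (Formula P)}
    {φ : Formula P} {l : List (Formula P)} (hl : ∀ γ ∈ l, γ ∈ Γ)
    (h : DerivableFrom A Γ (l.foldr imp φ)) : DerivableFrom A Γ φ := by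
  induction l with
  | nil => exact h
  | cons γ l ih =>
    exact ih (fun γ hγ => hl γ (List.mem_cons_of_mem _ hγ)) (h.mp (.mem (hl γ List.mem_cons_self)))

/-- Finiteness of `Γ` lets the pointwise consequence be stated as one formula, to which weak
completeness applies; modus ponens then discharges the assumptions. -/
theorem derivableFrom_arch_iff {Γ : Set (Formula P)} (hΓ : Γ.Finite) {φ : Formula P} :
    DerivableFrom Arch Γ φ ↔ DerivableFrom GArch Γ φ := by
  refine ⟨.mono fun _ _ => .of_arch, fun h => ?_⟩
  refine .of_derivable_foldr (l := hΓ.toFinset.toList) (by simp) (Derivable.derivableFrom ?_)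
  refine derivable_of_forall_sat fun F M x => ?_
  have key : ∀ l : List (Formula P), M.Sat (l.foldr imp φ) x ↔ ((∀ γ ∈ l, M.Sat γ x) → M.Sat φ x) :=
    fun l => by
      induction l with
      | nil => simp
      | cons γ l ih => simp [ih]
  exact (key _).2 fun hx => FiniteModel.sat_of_derivableFrom h (by simpa using hx)

end Equivalence

end DPL

theorem mainTheorem8 {P : Type*} [Countable P] [Nonempty P] :
    (∀ φ : DPL.Formula P, DPL.Derivable DPL.Arch φ ↔ DPL.Derivable DPL.GArch φ) ∧
    (∀ Γ : Set (DPL.Formula P), Γ.Finite → ∀ φ : DPL.Formula P,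
      DPL.DerivableFrom DPL.Arch Γ φ ↔ DPL.DerivableFrom DPL.GArch Γ φ) ∧
    (∀ Γ : Set (DPL.Formula P), Γ.Finite →
      (DPL.Consistent DPL.Arch Γ ↔ DPL.Consistent DPL.GArch Γ)) :=
  ⟨fun _ => DPL.derivable_arch_iff, fun _ hΓ _ => DPL.derivableFrom_arch_iff hΓ,
    fun _ hΓ => not_congr (DPL.derivableFrom_arch_iff hΓ)⟩
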